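/- **Setting.** Let $\mathcal X$ be a measurable space of experimental conditions, $\Theta\subset\mathbb R^{p+1}$ a compact parameter set and $\eta:\mathcal X\times\mathbb R^{p+1}\to\mathbb R$ a mean function, measurable in $x$ for every $\theta\in\Theta$. Let $\theta^t$ be the true parameter, an interior point of $\Theta$. For every $x$ the function $\eta(x,\cdot)$ is differentiable at each point of $\Theta$ and three times continuously differentiable in a neighbourhood of $\theta^t$. Let $\varepsilon_{imj}$ ($i=1,2$; $m,j\ge 1$) be i.i.d. $N(0,\sigma^2)$ errors with $\sigma>0$. A *design* $\xi$ is a finite list of points $x_1,\dots,x_M\in\mathcal X$ with weights $\omega_m\ge 0$, $\sum_m\omega_m=1$; its information matrix is $$M(\xi,\theta)=\sum_{m=1}^M\omega_m\,\nabla\eta(x_m,\theta)\nabla\eta(x_m,\theta)^T ,$$ the gradient being taken in $\theta$. **First stage.** For a fixed $n_1$ and a design $\xi_1$ with points $x_{1m}$ and weights $\omega_{1m}$ such that all $n_{1m}=n_1\omega_{1m}$ are integers, one observes $y_{1mj}=\eta(x_{1m},\theta^t)+\varepsilon_{1mj}$, $j\le n_{1m}$, with sample means $\bar y_1=(\bar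 y_{1m})_m$. Let $\hat\theta_{n_1}=\hat\theta_{n_1}(\bar y_1)$ be a maximizer over $\Theta$ of $\mathcal L_{1}(\theta)=\exp\{-\frac1{2\sigma^2}\sum_m n_{1m}[\bar y_{1m}-\eta(x_{1m},\theta)]^2\}$. **Second stage.** Let $\Phi$ be a criterion function on matrices with values in $[-\infty,\infty]$, and for $\theta\in\Theta$ let $\xi^*(\theta)$ be a locally optimal design, that is, a maximizer of $\Phi[M(\xi,\theta)]$ over all designs $\xi$. Put $\xi_2^*=\xi^*(\hat\theta_{n_1}(\bar y_1))$, a random design (a measurable function of $\bar y_1$) with points $x_{2m}$ and weights $\omega_{2m}$. For each $n_2$ one observes $y_{2mj}=\eta(x_{2m},\theta^t)+\varepsilon_{2mj}$, $j\le n_{2m}$, with sample means $\bar y_{2m}$, where the integers $n_{2m}\ge0$, measurable functions of the design, satisfy $\sum_m n_{2m}=n_2$ and $n_{2m}/n_2\to\omega_{2m}$ as $n_2\to\infty$ (for example, $n_2\omega_{2m}$ is rounded up or down to an integer). Let $n=n_1+n_2$ and let the random vector $\hat\theta_n$ maximize over $\Theta$ the total likelihood $\mathcal L_1(\theta)\,\mathcal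 L_2(\theta)$, where $\mathcal L_2(\theta)=\exp\{-\frac1{2\sigma^2}\sum_m n_{2m}[\bar y_{2m}-\eta(x_{2m},\theta)]^2\}$. Assume that almost surely (i) $\theta^t$ is identifiable under $\xi_2^*$: no $\theta\in\Theta$ with $\theta\ne\theta^t$ satisfies $\eta(x_{2m},\theta)=\eta(x_{2m},\theta^t)$ for all $m$ with $\omega_{2m}>0$; and (ii) $M(\xi_2^*,\theta^t)$ is positive definite. **Theorem.** With $n_1$ fixed, as $n_2\to\infty$, $$\sqrt n\,(\hat\theta_n-\theta^t)\ \xrightarrow{\ \mathscr D\ }\ \sigma\,M(\xi_2^*,\theta^t)^{-1/2}\,Z ,$$ where $Z$ is a $(p+1)$-dimensional standard normal random vector independent of the random matrix $M(\xi_2^*,\theta^t)$. Thus the limit law is the mixture of the normal laws $N(0,\sigma^2M(\xi_2^*,\theta^t)^{-1})$ over the distribution of $\xi_2^*$. -/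

import Mathlib

open MeasureTheory ProbabilityTheory Filter Topology
open scoped MatrixOrder

/-- The parameter space `ℝ^{p+1}` with its Euclidean norm. -/
abbrev Param (p : ℕ) : Type := EuclideanSpace ℝ (Fin (p + 1))

/-- An experimental design on `X`: a finite discrete probability distribution, given by its
experimental points and their nonnegative weights, which add up to one. -/
structure Design (X : Type*) where
  size : ℕ
  pt : Fin size → X
  wt : Fin size → ℝ
  wt_nonneg : ∀ m, 0 ≤ wt m
  wt_sum : ∑ m, wt m = 1

namespace Design

variable {X : Type*}

/-- The number of points, the points and the weights of a design, as an element of the disjoint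
union over `M` of `(X × ℝ)^M`. -/
def toSigma (ξ : Design X) : Σ M : ℕ, Fin M → X × ℝ :=
  ⟨ξ.size, fun m => (ξ.pt m, ξ.wt m)⟩

/-- A random design is one whose number of points, points and weights are random variables. -/
instance [MeasurableSpace X] : MeasurableSpace (Design X) :=
  MeasurableSpace.comap toSigma inferInstance

end Design

section Model

variable {X : Type*} {p : ℕ}

/-- The information matrix `M(ξ; θ) = ∫ ∇η(x,θ) ∇η(x,θ)ᵀ dξ(x)`; the gradient is taken in `θ`. -/
noncomputable def infoMatrix (η : X → Param p → ℝ) (ξ : Design X) (θ : Param p) :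
    Matrix (Fin (p + 1)) (Fin (p + 1)) ℝ :=
  ∑ m, ξ.wt m • Matrix.vecMulVec (gradient (η (ξ.pt m)) θ).ofLp (gradient (η (ξ.pt m)) θ).ofLp

/-- `ξ` is a locally optimal design at `θ` for the criterion `Φ`: it maximizes `Φ[M(·; θ)]` over
all designs. Values in `[-∞, ∞]` allow for criteria such as the logarithm of the determinant. -/
def IsLocallyOptimal (η : X → Param p → ℝ) (Φ : Matrix (Fin (p + 1)) (Fin (p + 1)) ℝ → EReal)
    (θ : Param p) (ξ : Design X) : Prop :=
  ∀ ξ' : Design X, Φ (infoMatrix η ξ' θ) ≤ Φ (infoMatrix η ξ θ)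

/-- The design `ξ` separates `θt` from every other parameter in `Θ`: no `θ ≠ θt` in `Θ` has the
same mean responses as `θt` at all points of `ξ` of positive weight. -/
def IdentifiesAt (η : X → Param p → ℝ) (Θ : Set (Param p)) (θt : Param p) (ξ : Design X) : Prop :=
  ∀ θ ∈ Θ, (∀ m, 0 < ξ.wt m → η (ξ.pt m) θ = η (ξ.pt m) θt) → θ = θt

/-- A rule `k` that turns the weights of a design into numbers of observations: with `N`
observations in total, `k N ξ m` are taken at the `m`-th point of `ξ`. The numbers add up to `N`
and the proportions converge to the weights, as they do for every rounding of `N * ξ.wt m` up or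
down to an integer. -/
structure IsRounding [MeasurableSpace X] (k : ℕ → (ξ : Design X) → Fin ξ.size → ℕ) : Prop where
  sum_eq : ∀ N ξ, ∑ m, k N ξ m = N
  tendsto : ∀ ξ m, Tendsto (fun N : ℕ => (k N ξ m : ℝ) / N) atTop (𝓝 (ξ.wt m))
  measurable : ∀ N, Measurable fun ξ : Design X => (⟨ξ.size, k N ξ⟩ : Σ M : ℕ, Fin M → ℕ)

/-- The sample means `ȳ_m` of the responses `y_{mj} = η(x_m, θt) + e_{mj}`, with `k m` observations
at the `m`-th point. (The mean of no observations is `0`; it enters the likelihood with factor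
`0`.) -/
noncomputable def sampleMean (η : X → Param p → ℝ) (θt : Param p) {M : ℕ} (x : Fin M → X)
    (k : Fin M → ℕ) (e : ℕ → ℕ → ℝ) (m : Fin M) : ℝ :=
  (∑ j ∈ Finset.range (k m), (η (x m) θt + e m j)) / k m

/-- The likelihood of one stage, up to a factor that does not depend on `θ`:
`exp(-(2σ²)⁻¹ ∑ m, k_m (ȳ_m - η(x_m, θ))²)`. -/
noncomputable def stageLikelihood (η : X → Param p → ℝ) (σ : ℝ) {M : ℕ} (x : Fin M → X)
    (k : Fin M → ℕ) (ybar : Fin M → ℝ) (θ : Param p) : ℝ :=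
  Real.exp (-(1 / (2 * σ ^ 2)) * ∑ m, (k m : ℝ) * (ybar m - η (x m) θ) ^ 2)

/-- `θhat` is a maximum likelihood estimate over `Θ` for the likelihood `L`. -/
def IsMLE (Θ : Set (Param p)) (L : Param p → ℝ) (θhat : Param p) : Prop :=
  θhat ∈ Θ ∧ ∀ θ ∈ Θ, L θ ≤ L θhat

/-- The second stage design, the locally optimal design rule `ξopt` evaluated at the first stage
maximum likelihood estimate `θhat₁`, which is a function of the first stage sample means. -/
noncomputable def secondDesign (η : X → Param p → ℝ) (θt : Param p) (ξ₁ : Design X)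
    (k₁ : Fin ξ₁.size → ℕ) (θhat₁ : (Fin ξ₁.size → ℝ) → Param p) (ξopt : Param p → Design X)
    (e₁ : ℕ → ℕ → ℝ) : Design X :=
  ξopt (θhat₁ (sampleMean η θt ξ₁.pt k₁ e₁))

/-- The total likelihood of the two-stage experiment with `N` second stage observations, where
`e₁` and `e₂` are the errors of the two stages and `ξ₂` is the second stage design. -/
noncomputable def totalLikelihood (η : X → Param p → ℝ) (σ : ℝ) (θt : Param p) (ξ₁ : Design X)
    (k₁ : Fin ξ₁.size → ℕ) (ξ₂ : Design X) (k₂ : Fin ξ₂.size → ℕ) (e₁ e₂ : ℕ → ℕ → ℝ)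
    (θ : Param p) : ℝ :=
  stageLikelihood η σ ξ₁.pt k₁ (sampleMean η θt ξ₁.pt k₁ e₁) θ *
    stageLikelihood η σ ξ₂.pt k₂ (sampleMean η θt ξ₂.pt k₂ e₂) θ

/-- `A^{-1/2}`, the positive semidefinite square root of `A⁻¹`, for a positive definite matrix
`A`. -/
noncomputable def invSqrt (A : Matrix (Fin (p + 1)) (Fin (p + 1)) ℝ) :
    Matrix (Fin (p + 1)) (Fin (p + 1)) ℝ :=
  CFC.sqrt A⁻¹

end Model

/-! The second-stage design is a function of the first-stage errors alone, hence independent of the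
second-stage errors. Once it is frozen, what remains is least squares with a fixed design and fresh
Gaussian noise, and the fixed first-stage term is negligible.

The analysis is done path by path. If the error averages at each point tend to zero, compactness and
identifiability give consistency (`tendsto_of_isMinOn_lsObjective`). Expanding the score equation
(`isLittleO_lsScore`) then shows that the standardized error `T` equals the linear term `S = M⁻¹
n^{-1/2} ∑ ε ∇η` up to `o(1 + ‖S‖)` (`tendsto_standardizedError_sub_linearizedError`). The error is
relative because the strong law alone does not keep `S` bounded along a path.

The law of `S` needs no central limit theorem: given the design it is exactly Gaussian, with
covariance tending to `σ² M⁻¹`. Averaging characteristic functions over the design by dominated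
convergence gives the normal mixture (`tendstoInDistribution_linearizedError`). With `V = (T - S) /
(1 + ‖S‖) → 0` almost surely, `T = S + (1 + ‖S‖) V` is a continuous function of `(S, V)`, and
Slutsky's theorem concludes. -/

/-! ### Measurability of matrix operations -/

instance Matrix.instMeasurableSpaceOfPi {m n : Type*} : MeasurableSpace (Matrix m n ℝ) :=
  inferInstanceAs (MeasurableSpace (m → n → ℝ))

instance Matrix.instBorelSpaceOfPi {m n : Type*} [Countable m] [Countable n] :
    BorelSpace (Matrix m n ℝ) :=
  inferInstanceAs (BorelSpace (m → n → ℝ))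

/-- The formula `det⁻¹ • adjugate` also covers singular matrices, since both conventions give zero
there. -/
lemma Matrix.measurable_inv {n : Type*} [Fintype n] [DecidableEq n] :
    Measurable fun A : Matrix n n ℝ => A⁻¹ := by
  refine measurable_pi_lambda _ fun i => measurable_pi_lambda _ fun j => ?_
  have hdet : Measurable fun A : Matrix n n ℝ => A.det :=
    (Continuous.matrix_det continuous_id).measurable
  have hadj : Measurable fun A : Matrix n n ℝ => A.adjugate i j :=
    ((Continuous.matrix_adjugate continuous_id).matrix_elem i j).measurable
  simp only [Matrix.inv_def, Ring.inverse_eq_inv', Matrix.smul_apply, smul_eq_mul]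
  exact hdet.inv.mul hadj

lemma Matrix.isClosed_setOf_posSemidef {n : Type*} [Fintype n] :
    IsClosed {A : Matrix n n ℝ | A.PosSemidef} := by
  have : {A : Matrix n n ℝ | A.PosSemidef} =
      {A | A.conjTranspose = A} ∩ ⋂ x : n → ℝ, {A | 0 ≤ star x ⬝ᵥ (A.mulVec x)} := by
    ext A
    simp [Matrix.posSemidef_iff_dotProduct_mulVec, Matrix.IsHermitian]
  rw [this]
  refine (isClosed_eq (by fun_prop) continuous_id).inter (isClosed_iInter fun x => ?_)
  exact isClosed_le continuous_const (by fun_prop)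

-- The root is continuous on the closed cone of positive semidefinite matrices and is zero by
-- convention off it.
open scoped Matrix.Norms.L2Operator in
lemma Matrix.measurable_cfcSqrt {n : Type*} [Fintype n] [DecidableEq n] :
    Measurable (CFC.sqrt : Matrix n n ℝ → Matrix n n ℝ) := by
  classical
  have hset : {A : Matrix n n ℝ | 0 ≤ A} = {A | A.PosSemidef} := by
    ext A; exact Matrix.nonneg_iff_posSemidef
  have hcl : IsClosed {A : Matrix n n ℝ | 0 ≤ A} := hset ▸ Matrix.isClosed_setOf_posSemidef
  have hpw : (CFC.sqrt : Matrix n n ℝ → Matrix n n ℝ) =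
      Set.piecewise {A : Matrix n n ℝ | 0 ≤ A} CFC.sqrt (fun _ => 0) := by
    ext1 A
    by_cases hA : 0 ≤ A
    · rw [Set.piecewise_eq_of_mem _ _ _ (by exact hA)]
    · rw [Set.piecewise_eq_of_notMem _ _ _ (by exact hA), CFC.sqrt_of_not_nonneg hA]
  rw [hpw]
  exact CFC.continuousOn_sqrt.measurable_piecewise continuousOn_const hcl.measurableSet

lemma Matrix.measurable_toEuclideanCLM_apply {n : Type*} [Fintype n] [DecidableEq n] :
    Measurable fun q : Matrix n n ℝ × EuclideanSpace ℝ n =>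
      Matrix.toEuclideanCLM (𝕜 := ℝ) q.1 q.2 := by
  have h : Continuous fun q : Matrix n n ℝ × EuclideanSpace ℝ n => q.1.mulVec q.2.ofLp :=
    continuous_fst.matrix_mulVec ((PiLp.continuous_ofLp 2 _).comp continuous_snd)
  have h' := (PiLp.continuous_toLp 2 _).comp h
  refine (h'.congr fun q => ?_).measurable
  simp [← Matrix.ofLp_toEuclideanCLM]

/-! ### Measurable functions of designs -/

lemma measurable_of_sigma {ι γ : Type*} {β : ι → Type*} [∀ i, MeasurableSpace (β i)]
    [MeasurableSpace γ] {f : Sigma β → γ} (h : ∀ i, Measurable fun x : β i => f ⟨i, x⟩) :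
    Measurable f := by
  intro s hs
  rw [show (MeasurableSet (f ⁻¹' s) ↔ _) from MeasurableSpace.measurableSet_iInf]
  exact fun i => h i hs

/-- Padding with the default `b` turns a coordinate whose index type depends on the point into a
function defined for every natural `m`. -/
lemma measurable_sigmaFin_apply {α β : Type*} [MeasurableSpace α] [MeasurableSpace β]
    {h : α → β} (hh : Measurable h) (b : β) (m : ℕ) :
    Measurable fun s : Σ M : ℕ, Fin M → α => if hm : m < s.1 then h (s.2 ⟨m, hm⟩) else b := by
  refine measurable_of_sigma fun M => ?_
  by_cases hm : m < M
  · simp only [hm, dif_pos]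
    exact hh.comp (measurable_pi_apply (⟨m, hm⟩ : Fin M))
  · simp [hm]

lemma measurable_sum_range {Y E : Type*} [MeasurableSpace Y] [MeasurableSpace E] [AddCommMonoid E]
    [MeasurableAdd₂ E] {n : Y → ℕ} (hn : Measurable n) {f : ℕ → Y → E}
    (hf : ∀ j, Measurable (f j)) : Measurable fun y => ∑ j ∈ Finset.range (n y), f j y := by
  have : Measurable fun q : ℕ × Y => ∑ j ∈ Finset.range q.1, f j q.2 :=
    measurable_from_prod_countable_right fun k =>
      Finset.measurable_sum (f := f) (Finset.range k) fun j _ => hf j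
  exact this.comp (hn.prodMk measurable_id)

namespace Design

variable {X : Type*} [MeasurableSpace X]

lemma measurable_toSigma : Measurable (toSigma : Design X → _) := comap_measurable _

lemma measurable_size : Measurable (size : Design X → ℕ) := by
  have : Measurable (Sigma.fst : (Σ M : ℕ, Fin M → X × ℝ) → ℕ) :=
    measurable_of_sigma fun _ => measurable_const
  exact this.comp measurable_toSigma

lemma measurable_apply_pt {β : Type*} [MeasurableSpace β] {g : X → β} (hg : Measurable g)
    (b : β) (m : ℕ) :
    Measurable fun ξ : Design X => if hm : m < ξ.size then g (ξ.pt ⟨m, hm⟩) else b :=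
  (measurable_sigmaFin_apply (hg.comp measurable_fst) b m).comp measurable_toSigma

end Design

section

variable {X : Type*} [MeasurableSpace X] {p : ℕ}

lemma measurable_infoMatrix {η : X → Param p → ℝ} {θ : Param p}
    (hg : Measurable fun x => gradient (η x) θ) :
    Measurable fun ξ : Design X => infoMatrix η ξ θ := by
  have : Measurable fun s : Σ M : ℕ, Fin M → X × ℝ => (∑ m, (s.2 m).2 •
      Matrix.vecMulVec (gradient (η (s.2 m).1) θ).ofLp (gradient (η (s.2 m).1) θ).ofLp :
        Matrix (Fin (p + 1)) (Fin (p + 1)) ℝ) := by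
    refine measurable_of_sigma fun M => ?_
    refine measurable_pi_lambda _ fun i => measurable_pi_lambda _ fun j => ?_
    have hgi : ∀ i, Measurable fun x => (gradient (η x) θ).ofLp i := fun i =>
      (EuclideanSpace.proj (𝕜 := ℝ) i).continuous.measurable.comp hg
    simp only [Matrix.sum_apply, Matrix.smul_apply, Matrix.vecMulVec_apply, smul_eq_mul]
    change Measurable fun x : Fin M → X × ℝ => ∑ m : Fin M, (x m).2 *
      ((gradient (η (x m).1) θ).ofLp i * (gradient (η (x m).1) θ).ofLp j)
    refine Finset.measurable_sum _ fun m _ => ?_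
    have hm : Measurable fun x : Fin M → X × ℝ => x m := measurable_pi_apply m
    exact hm.snd.mul (((hgi i).comp hm.fst).mul ((hgi j).comp hm.fst))
  exact this.comp Design.measurable_toSigma

/-- The sum of the errors of a stage, each weighted by the value of `g` at its design point. -/
noncomputable def weightedErrorSum {M : ℕ} (g : Fin M → Param p) (k : Fin M → ℕ)
    (e : ℕ → ℕ → ℝ) : Param p :=
  ∑ m, (∑ j ∈ Finset.range (k m), e m j) • g m

/-- Padding by zero turns the sum over `Fin ξ.size` into one over a random range, and random ranges
take only countably many values. -/
lemma measurable_weightedErrorSum {k : (ξ : Design X) → Fin ξ.size → ℕ}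
    (hk : Measurable fun ξ : Design X => (⟨ξ.size, k ξ⟩ : Σ M : ℕ, Fin M → ℕ))
    {g : X → Param p} (hg : Measurable g) :
    Measurable fun q : Design X × (ℕ → ℕ → ℝ) =>
      weightedErrorSum (fun m => g (q.1.pt m)) (k q.1) q.2 := by
  have hK : ∀ m : ℕ, Measurable fun ξ : Design X => if hm : m < ξ.size then k ξ ⟨m, hm⟩ else 0 :=
    fun m => (measurable_sigmaFin_apply measurable_id 0 m).comp hk
  have h : Measurable fun q : Design X × (ℕ → ℕ → ℝ) => ∑ m ∈ Finset.range q.1.size,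
      (∑ j ∈ Finset.range (if hm : m < q.1.size then k q.1 ⟨m, hm⟩ else 0), q.2 m j) •
        (if hm : m < q.1.size then g (q.1.pt ⟨m, hm⟩) else 0) := by
    refine measurable_sum_range (Design.measurable_size.comp measurable_fst) fun m => ?_
    refine Measurable.smul (measurable_sum_range (E := ℝ) ((hK m).comp measurable_fst) fun j => ?_)
      ((Design.measurable_apply_pt hg 0 m).comp measurable_fst)
    exact (measurable_pi_apply j).comp ((measurable_pi_apply m).comp measurable_snd)
  convert h using 2 with q
  rw [weightedErrorSum, Finset.sum_fin_eq_sum_range]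
  refine Finset.sum_congr rfl fun m hm => ?_
  simp [Finset.mem_range.1 hm]

/-- Each coordinate is a limit of difference quotients of functions measurable in `x`. -/
lemma measurable_gradient {η : X → Param p → ℝ} {Θ : Set (Param p)} {θ : Param p}
    (hθ : θ ∈ interior Θ) (hmeas : ∀ θ ∈ Θ, Measurable fun x => η x θ)
    (hdiff : ∀ x, DifferentiableAt ℝ (η x) θ) : Measurable fun x => gradient (η x) θ := by
  suffices h : ∀ i, Measurable fun x => (gradient (η x) θ).ofLp i by
    have h1 : Measurable fun x => (gradient (η x) θ).ofLp := measurable_pi_lambda _ h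
    exact (PiLp.continuous_toLp 2 _).measurable.comp h1
  intro i
  set v : Param p := EuclideanSpace.single i (1 : ℝ)
  have hev : ∀ᶠ n : ℕ in atTop, θ + ((n : ℝ) + 1)⁻¹ • v ∈ Θ := by
    have ht : Tendsto (fun n : ℕ => θ + ((n : ℝ) + 1)⁻¹ • v) atTop (𝓝 (θ + (0 : ℝ) • v)) := by
      have := tendsto_one_div_add_atTop_nhds_zero_nat (𝕜 := ℝ)
      simp only [one_div] at this
      exact tendsto_const_nhds.add (this.smul_const v)
    rw [zero_smul, add_zero] at ht
    exact ht (mem_interior_iff_mem_nhds.1 hθ)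
  obtain ⟨n₀, hn₀⟩ := eventually_atTop.1 hev
  -- The shift by `n₀` keeps every evaluation point inside `Θ`, where measurability in `x` is known.
  refine measurable_of_tendsto_metrizable
    (f := fun n x => (((n + n₀ : ℕ) : ℝ) + 1) *
      (η x (θ + (((n + n₀ : ℕ) : ℝ) + 1)⁻¹ • v) - η x θ)) (fun n => ?_) ?_
  · exact (((hmeas _ (hn₀ _ (by omega))).sub (hmeas _ (interior_subset hθ)))).const_mul _
  · rw [tendsto_pi_nhds]
    intro x
    have hd := (hdiff x).hasGradientAt.hasFDerivAt
    have hlim := hd.lim_real v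
    have htop : Tendsto (fun n : ℕ => ((n + n₀ : ℕ) : ℝ) + 1) atTop atTop :=
      tendsto_atTop_add_const_right _ _
        (tendsto_natCast_atTop_atTop.comp (tendsto_add_atTop_nat n₀))
    have := hlim.comp htop
    have hv : InnerProductSpace.toDual ℝ (Param p) (gradient (η x) θ) v
        = (gradient (η x) θ).ofLp i := by
      rw [InnerProductSpace.toDual_apply_apply, EuclideanSpace.inner_single_right]
      simp
    rw [hv] at this
    simpa [Function.comp_def] using this

end

/-! ### Least squares estimators along a fixed sequence of errors -/

open Asymptotics RealInnerProductSpace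

section LeastSquares

variable {p M : ℕ} {Θ : Set (Param p)} {θt : Param p} {f : Fin M → Param p → ℝ}
  {q : Param p → ℝ} {w : Fin M → ℝ} {k s : ℕ → Fin M → ℝ} {r : ℕ → ℝ} {θ : ℕ → Param p}

/-- The least squares objective, up to a constant: `q` collects the observations of the first
stage, `k m` observations with the error sum `s m` are taken of the response `f m`. -/
def lsObjective (θt : Param p) (f : Fin M → Param p → ℝ) (q : Param p → ℝ) (k s : Fin M → ℝ)
    (θ : Param p) : ℝ :=
  q θ + ∑ m, (k m * (f m θ - f m θt) ^ 2 - 2 * s m * (f m θ - f m θt))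

/-- At a cluster point `ϑ`, comparing with `θt` and dividing by `r` removes both `q` and the noise,
leaving `∑ w (f ϑ - f θt)² ≤ 0`. Identifiability forces `ϑ = θt`, and compactness turns uniqueness
of cluster points into convergence. -/
lemma tendsto_of_isMinOn_lsObjective (hΘ : IsCompact Θ) (hf : ∀ m, ContinuousOn (f m) Θ)
    (hq : ∀ θ, 0 ≤ q θ) (hw : ∀ m, 0 ≤ w m)
    (hident : ∀ θ ∈ Θ, (∀ m, 0 < w m → f m θ = f m θt) → θ = θt)
    (hr : Tendsto r atTop atTop)
    (hk : ∀ m, Tendsto (fun N => k N m / r N) atTop (𝓝 (w m)))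
    (hs : ∀ m, Tendsto (fun N => s N m / r N) atTop (𝓝 0))
    (hmem : ∀ N, θ N ∈ Θ)
    (hmin : ∀ N, lsObjective θt f q (k N) (s N) (θ N) ≤ lsObjective θt f q (k N) (s N) θt) :
    Tendsto θ atTop (𝓝 θt) := by
  refine hΘ.tendsto_nhds_of_unique_mapClusterPt (Eventually.of_forall hmem) fun ϑ hϑ hcl => ?_
  obtain ⟨u, hu, hlim⟩ := mapClusterPt_iff_ultrafilter.1 hcl
  have hd : ∀ m, Tendsto (fun N => f m (θ N) - f m θt) u (𝓝 (f m ϑ - f m θt)) := fun m =>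
    (((hf m ϑ hϑ).tendsto).comp (tendsto_nhdsWithin_iff.2
      ⟨hlim, Eventually.of_forall hmem⟩)).sub_const _
  have hL : Tendsto (fun N => ∑ m, (k N m / r N * (f m (θ N) - f m θt) ^ 2
      - 2 * (s N m / r N) * (f m (θ N) - f m θt))) u
      (𝓝 (∑ m, (w m * (f m ϑ - f m θt) ^ 2 - 2 * 0 * (f m ϑ - f m θt)))) :=
    tendsto_finsetSum _ fun m _ => (((hk m).mono_left hu).mul ((hd m).pow 2)).sub
      ((((hs m).mono_left hu).const_mul 2).mul (hd m))
  have hR : Tendsto (fun N => q θt / r N) u (𝓝 0) := (hr.mono_left hu).const_div_atTop (q θt)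
  have hle : ∑ m, (w m * (f m ϑ - f m θt) ^ 2 - 2 * 0 * (f m ϑ - f m θt)) ≤ 0 := by
    refine le_of_tendsto_of_tendsto hL hR ?_
    filter_upwards [hu (hr.eventually_gt_atTop 0)] with N hN
    have h := hmin N
    simp only [lsObjective, sub_self, ne_eq, OfNat.ofNat_ne_zero, not_false_eq_true, zero_pow,
      mul_zero, Finset.sum_const_zero, add_zero] at h
    have h2 : ∑ m, (k N m * (f m (θ N) - f m θt) ^ 2 - 2 * s N m * (f m (θ N) - f m θt)) ≤
        q θt := by
      linarith [hq (θ N)]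
    rw [le_div_iff₀ hN, Finset.sum_mul]
    refine le_of_eq_of_le (Finset.sum_congr rfl fun m _ => ?_) h2
    field_simp
  simp only [mul_zero, zero_mul, sub_zero] at hle
  have h0 := (Finset.sum_eq_zero_iff_of_nonneg fun m _ =>
    mul_nonneg (hw m) (sq_nonneg (f m ϑ - f m θt))).1
    (le_antisymm hle (Finset.sum_nonneg fun m _ => mul_nonneg (hw m) (sq_nonneg _)))
  refine hident ϑ hϑ fun m hm => ?_
  have := h0 m (Finset.mem_univ m)
  rcases mul_eq_zero.1 this with h | h
  · exact absurd h hm.ne'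
  · exact sub_eq_zero.1 (pow_eq_zero_iff two_ne_zero |>.1 h)

lemma ContDiffAt.continuousAt_gradient {f : Param p → ℝ} {x : Param p}
    (hf : ContDiffAt ℝ 1 f x) : ContinuousAt (gradient f) x :=
  (InnerProductSpace.toDual ℝ (Param p)).symm.continuous.continuousAt.comp
    (hf.fderiv_right (m := 0) (by norm_num)).continuousAt

lemma ContDiffAt.isBigO_gradient_sub {f : Param p → ℝ} {x : Param p}
    (hf : ContDiffAt ℝ 2 f x) :
    (fun y => gradient f y - gradient f x) =O[𝓝 x] fun y => y - x := by
  have h := ((hf.fderiv_right (m := 1) (by norm_num)).differentiableAt (by norm_num)).isBigO_sub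
  refine (IsBigO.of_bound 1 (Eventually.of_forall fun y => ?_)).trans h
  rw [one_mul, gradient, gradient, ← map_sub, LinearIsometryEquiv.norm_map]

lemma lsObjective_score_eq_zero {k s : Fin M → ℝ} {ϑ : Param p} (hϑ : ϑ ∈ interior Θ)
    (hf : ∀ m, DifferentiableAt ℝ (f m) ϑ) (hq : DifferentiableAt ℝ q ϑ)
    (hmin : ∀ θ ∈ Θ, lsObjective θt f q k s ϑ ≤ lsObjective θt f q k s θ) :
    gradient q ϑ + ∑ m, (2 * (k m * (f m ϑ - f m θt) - s m)) • gradient (f m) ϑ = 0 := by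
  have hloc : IsLocalMin (lsObjective θt f q k s) ϑ := by
    filter_upwards [mem_interior_iff_mem_nhds.1 hϑ] with θ hθ using hmin θ hθ
  have hd : ∀ m, HasFDerivAt
      (fun θ => k m * (f m θ - f m θt) ^ 2 - 2 * s m * (f m θ - f m θt))
      ((2 * (k m * (f m ϑ - f m θt) - s m)) • fderiv ℝ (f m) ϑ) ϑ := fun m => by
    have h1 := (hf m).hasFDerivAt.sub_const (f m θt)
    refine (((h1.pow 2).const_mul (k m)).sub (h1.const_mul (2 * s m))).congr_fderiv ?_
    ext v
    simp
    ring
  have h := hq.hasFDerivAt.add (HasFDerivAt.fun_sum (u := Finset.univ) fun m _ => hd m)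
  have h0 := hloc.hasFDerivAt_eq_zero h
  have := congrArg (InnerProductSpace.toDual ℝ (Param p)).symm h0
  simpa [map_add, map_sum, gradient] using this

/-- Linearization of the score equation. No bound on `D = √r (θ - θt)` is available yet, so every
remainder is measured against `1 + ‖D‖`. -/
lemma isLittleO_lsScore (hθt : θt ∈ interior Θ) (hf : ∀ m, ContDiffAt ℝ 2 (f m) θt)
    (hq : ContDiffAt ℝ 1 q θt) (hr : Tendsto r atTop atTop)
    (hk : ∀ m, Tendsto (fun N => k N m / r N) atTop (𝓝 (w m)))
    (hs : ∀ m, Tendsto (fun N => s N m / r N) atTop (𝓝 0))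
    (hθ : Tendsto θ atTop (𝓝 θt))
    (hmin : ∀ N, ∀ ϑ ∈ Θ,
      lsObjective θt f q (k N) (s N) (θ N) ≤ lsObjective θt f q (k N) (s N) ϑ) :
    (fun N => (∑ m, (w m * ⟪gradient (f m) θt, √(r N) • (θ N - θt)⟫) • gradient (f m) θt)
        - (√(r N))⁻¹ • ∑ m, s N m • gradient (f m) θt)
      =o[atTop] fun N => 1 + ‖√(r N) • (θ N - θt)‖ := by
  set D : ℕ → Param p := fun N => √(r N) • (θ N - θt) with hD
  set g : Fin M → Param p := fun m => gradient (f m) θt with hg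
  set G : Fin M → ℕ → Param p := fun m N => gradient (f m) (θ N) with hG
  set d : Fin M → ℕ → ℝ := fun m N => f m (θ N) - f m θt with hdd
  have hDO : D =O[atTop] fun N => 1 + ‖D N‖ := IsBigO.of_bound 1 <| Eventually.of_forall fun N => by
    rw [one_mul, Real.norm_of_nonneg (by positivity)]; linarith
  have h1O : (fun _ : ℕ => (1 : ℝ)) =O[atTop] fun N => 1 + ‖D N‖ :=
    IsBigO.of_bound 1 <| Eventually.of_forall fun N => by
      rw [one_mul, Real.norm_of_nonneg (by positivity : 0 ≤ 1 + ‖D N‖), norm_one]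
      linarith [norm_nonneg (D N)]
  have hsc : ∀ {F : Type} [NormedAddCommGroup F] [NormedSpace ℝ F] {v : ℕ → F},
      v =O[atTop] (fun N => θ N - θt) → (fun N => √(r N) • v N) =O[atTop] D := fun h =>
    (isBigO_refl _ _).smul h
  have hsco : ∀ {F : Type} [NormedAddCommGroup F] [NormedSpace ℝ F] {v : ℕ → F},
      v =o[atTop] (fun N => θ N - θt) → (fun N => √(r N) • v N) =o[atTop] D := fun h =>
    (isBigO_refl _ _).smul_isLittleO h
  have hdiff : ∀ m, HasFDerivAt (f m) (InnerProductSpace.toDual ℝ (Param p) (g m)) θt := fun m =>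
    ((hf m).differentiableAt (by norm_num)).hasGradientAt.hasFDerivAt
  have hdlo : ∀ m, (fun N => √(r N) • (d m N - ⟪g m, θ N - θt⟫)) =o[atTop] D := fun m =>
    hsco ((hdiff m).isLittleO.comp_tendsto hθ)
  have hdO : ∀ m, (fun N => √(r N) • d m N) =O[atTop] D := fun m =>
    hsc ((hdiff m).isBigO_sub.comp_tendsto hθ)
  have hGO : ∀ m, (fun N => √(r N) • (G m N - g m)) =O[atTop] D := fun m =>
    hsc ((hf m).isBigO_gradient_sub.comp_tendsto hθ)
  have hG0 : ∀ m, (fun N => g m - G m N) =o[atTop] fun _ => (1 : ℝ) := fun m => by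
    rw [isLittleO_one_iff]
    have := ((((hf m).of_le (by norm_num)).continuousAt_gradient).tendsto.comp hθ).const_sub (g m)
    simpa [hg, hG] using this
  have hk1 : ∀ m, (fun N => k N m / r N) =O[atTop] fun _ => (1 : ℝ) := fun m => (hk m).isBigO_one ℝ
  have hinn : ∀ m, (fun N => ⟪g m, D N⟫) =O[atTop] D := fun m =>
    (innerSL ℝ (g m)).isBigO_comp D atTop
  have hgO : ∀ m, (fun _ : ℕ => g m) =O[atTop] fun _ => (1 : ℝ) := fun m =>
    isBigO_const_const (g m) one_ne_zero _
  -- The five remainders are the weight error, the Taylor error of the response, the drift of the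
  -- gradient against the signal and against the noise, and the first-stage score. For the noise
  -- drift, `s / r → 0` suffices because `√r (G - g) = O(D)`.
  have hfin : (fun N => ∑ m, ((w m - k N m / r N) • (⟪g m, D N⟫ • g m)
      - (k N m / r N) • ((√(r N) • (d m N - ⟪g m, θ N - θt⟫)) • g m)
      + (k N m / r N) • ((√(r N) • d m N) • (g m - G m N))
      + (s N m / r N) • (√(r N) • (G m N - g m)))
      - (1 / 2 : ℝ) • ((√(r N))⁻¹ • gradient q (θ N)))
      =o[atTop] fun N => 1 + ‖D N‖ := by
    refine IsLittleO.sub (IsLittleO.fun_sum fun m _ => ((IsLittleO.sub ?_ ?_).add ?_).add ?_) ?_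
    · have h0 : (fun N => w m - k N m / r N) =o[atTop] fun _ => (1 : ℝ) := by
        rw [isLittleO_one_iff]; simpa using (hk m).const_sub (w m)
      have := h0.smul_isBigO (((hinn m).trans hDO).smul (hgO m))
      simpa using this
    · have := (hk1 m).smul_isLittleO (((hdlo m).trans_isBigO hDO).smul_isBigO (hgO m))
      simpa using this
    · have := (hk1 m).smul_isLittleO (((hdO m).trans hDO).smul_isLittleO (hG0 m))
      simpa using this
    · have h0 : (fun N => s N m / r N) =o[atTop] fun _ => (1 : ℝ) := by
        rw [isLittleO_one_iff]; exact hs m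
      have := h0.smul_isBigO ((hGO m).trans hDO)
      simpa using this
    · refine IsLittleO.const_smul_left (f' := fun N => (√(r N))⁻¹ • gradient q (θ N)) ?_
        (1 / 2 : ℝ)
      refine IsLittleO.trans_isBigO ?_ h1O
      rw [isLittleO_one_iff]
      have h1 : Tendsto (fun N => (√(r N))⁻¹) atTop (𝓝 0) :=
        (Real.tendsto_sqrt_atTop.comp hr).inv_tendsto_atTop
      simpa using h1.smul ((hq.continuousAt_gradient).tendsto.comp hθ)
  refine hfin.congr' ?_ (EventuallyEq.refl _ _)
  have hev1 : ∀ᶠ N in atTop, θ N ∈ interior Θ := hθ (isOpen_interior.mem_nhds hθt)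
  have hev2 : ∀ᶠ N in atTop, DifferentiableAt ℝ q (θ N) :=
    hθ.eventually ((hq.eventually (by norm_num)).mono fun _ h => h.differentiableAt (by norm_num))
  have hev3 : ∀ᶠ N in atTop, ∀ m, DifferentiableAt ℝ (f m) (θ N) := eventually_all.2 fun m =>
    hθ.eventually (((hf m).eventually (by norm_num)).mono
      fun _ h => h.differentiableAt (by norm_num))
  filter_upwards [hev1, hev2, hev3, hr.eventually_gt_atTop 0] with N h1 h2 h3 hN
  have hscore := lsObjective_score_eq_zero h1 h3 h2 (hmin N)
  -- Eliminating the first-stage score makes the five remainders add up exactly to the claimed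
  -- difference; the factor `1 / 2` cancels the `2` from differentiating squares.
  have hq' : gradient q (θ N) = - ∑ m, (2 * (k N m * d m N - s N m)) • G m N :=
    eq_neg_of_add_eq_zero_left hscore
  have hτ : 0 < √(r N) := Real.sqrt_pos.2 hN
  have hτr : √(r N) / r N = (√(r N))⁻¹ := by
    rw [Real.sqrt_div_self', one_div]
  rw [hq', smul_neg, smul_neg, sub_neg_eq_add, Finset.smul_sum, Finset.smul_sum, Finset.smul_sum,
    ← Finset.sum_add_distrib, ← Finset.sum_sub_distrib]
  refine Finset.sum_congr rfl fun m _ => ?_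
  have e1 : ∀ a : ℝ, a / r N * √(r N) = a * (√(r N))⁻¹ := fun a => by
    rw [← hτr]; ring
  have e2 : ⟪g m, D N⟫ = √(r N) * ⟪g m, θ N - θt⟫ := by simp [hD, inner_smul_right]
  rw [e2]
  simp only [smul_sub, smul_smul, smul_eq_mul, mul_sub, sub_mul, sub_smul]
  have e3 : k N m / r N * (√(r N) * d m N) = k N m * ((√(r N))⁻¹ * d m N) := by
    rw [← mul_assoc, e1, mul_assoc]
  rw [e3, e1]
  have e4 : (1 / 2 : ℝ) * ((√(r N))⁻¹ * (2 * (k N m * d m N))) =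
    k N m * ((√(r N))⁻¹ * d m N) := by ring
  have e5 : (1 / 2 : ℝ) * ((√(r N))⁻¹ * (2 * s N m)) = s N m * (√(r N))⁻¹ := by ring
  rw [e4, e5, mul_comm (√(r N))⁻¹ (s N m)]
  abel

lemma toEuclideanCLM_sum_smul_vecMulVec (w : Fin M → ℝ) (g : Fin M → Param p) (v : Param p) :
    Matrix.toEuclideanCLM (𝕜 := ℝ) (∑ m, w m • Matrix.vecMulVec (g m).ofLp (g m).ofLp) v =
      ∑ m, (w m * ⟪g m, v⟫) • g m := by
  ext i
  simp only [map_sum, map_smul, sum_apply, smul_apply,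
    WithLp.ofLp_sum, Finset.sum_apply, PiLp.smul_apply, Matrix.ofLp_toEuclideanCLM,
    Matrix.vecMulVec_mulVec, smul_eq_mul]
  refine Finset.sum_congr rfl fun m _ => ?_
  simp [PiLp.inner_apply, dotProduct, mul_comm, mul_left_comm]

/-- Absorption: once `‖T - S‖ ≤ (1 + ‖T‖) / 2`, one gets `1 + ‖T‖ ≤ 2 (1 + ‖S‖)`, so the error is
also small relative to `S`. -/
lemma tendsto_smul_sub_of_isLittleO {E : Type*} [NormedAddCommGroup E] [NormedSpace ℝ E]
    {S T : ℕ → E} (h : (fun N => T N - S N) =o[atTop] fun N => 1 + ‖T N‖) :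
    Tendsto (fun N => (1 + ‖S N‖)⁻¹ • (T N - S N)) atTop (𝓝 0) := by
  have h1 : (fun N => T N - S N) =o[atTop] fun N => 1 + ‖S N‖ := by
    refine h.trans_isBigO (IsBigO.of_bound 2 ?_)
    filter_upwards [h.bound (show (0 : ℝ) < 1 / 2 by norm_num)] with N hN
    rw [Real.norm_of_nonneg (by positivity)] at *
    rw [Real.norm_of_nonneg (by positivity)]
    have : ‖T N‖ ≤ ‖T N - S N‖ + ‖S N‖ := by simpa using norm_add_le (T N - S N) (S N)
    linarith
  have h2 := (isBigO_refl (fun N => (1 + ‖S N‖)⁻¹) atTop).smul_isLittleO h1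
  rw [← isLittleO_one_iff ℝ]
  refine h2.congr_right fun N => ?_
  rw [smul_eq_mul, inv_mul_cancel₀ (by positivity)]

end LeastSquares

/-! ### The maximum likelihood estimator along a fixed sequence of errors -/

section Path

variable {X : Type*} {p : ℕ} {η : X → Param p → ℝ} {θt : Param p}

/-- Isolates the part that does not depend on `θ`, which cancels when likelihoods are compared. The
case `k m = 0` is consistent, both sides being zero. -/
lemma natCast_mul_sampleMean_sub_sq {M : ℕ} (x : Fin M → X) (k : Fin M → ℕ) (e : ℕ → ℕ → ℝ)
    (m : Fin M) (θ : Param p) :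
    (k m : ℝ) * (sampleMean η θt x k e m - η (x m) θ) ^ 2 =
      k m * (sampleMean η θt x k e m - η (x m) θt) ^ 2 +
        (k m * (η (x m) θ - η (x m) θt) ^ 2
          - 2 * (∑ j ∈ Finset.range (k m), e m j) * (η (x m) θ - η (x m) θt)) := by
  have h : (k m : ℝ) * sampleMean η θt x k e m =
      k m * η (x m) θt + ∑ j ∈ Finset.range (k m), e m j := by
    rcases Nat.eq_zero_or_pos (k m) with h0 | h0
    · simp [h0]
    · have : (k m : ℝ) ≠ 0 := by positivity
      rw [sampleMean, mul_div_cancel₀ _ this, Finset.sum_add_distrib]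
      simp
  linear_combination (-2 * (η (x m) θ - η (x m) θt)) * h

lemma lsObjective_le_of_isMLE {Θ : Set (Param p)} {σ : ℝ} (hσ : 0 < σ) {ξ₁ ξ₂ : Design X}
    {k₁ : Fin ξ₁.size → ℕ} {k₂ : Fin ξ₂.size → ℕ} {e₁ e₂ : ℕ → ℕ → ℝ} {ϑ : Param p}
    (h : IsMLE Θ (totalLikelihood η σ θt ξ₁ k₁ ξ₂ k₂ e₁ e₂) ϑ) {θ : Param p} (hθ : θ ∈ Θ) :
    lsObjective θt (fun m => η (ξ₂.pt m))
        (fun θ => ∑ m, (k₁ m : ℝ) * (sampleMean η θt ξ₁.pt k₁ e₁ m - η (ξ₁.pt m) θ) ^ 2)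
        (fun m => k₂ m) (fun m => ∑ j ∈ Finset.range (k₂ m), e₂ m j) ϑ ≤
      lsObjective θt (fun m => η (ξ₂.pt m))
        (fun θ => ∑ m, (k₁ m : ℝ) * (sampleMean η θt ξ₁.pt k₁ e₁ m - η (ξ₁.pt m) θ) ^ 2)
        (fun m => k₂ m) (fun m => ∑ j ∈ Finset.range (k₂ m), e₂ m j) θ := by
  have h1 := h.2 θ hθ
  simp only [totalLikelihood, stageLikelihood, ← Real.exp_add, ← mul_add, Real.exp_le_exp] at h1
  have hc : 0 < 1 / (2 * σ ^ 2) := by positivity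
  rw [neg_mul, neg_mul, neg_le_neg_iff] at h1
  have h2 := le_of_mul_le_mul_left h1 hc
  have hsum : ∀ θ, _ := fun θ => Finset.sum_congr rfl fun m (_ : m ∈ Finset.univ) =>
    natCast_mul_sampleMean_sub_sq (η := η) (θt := θt) ξ₂.pt k₂ e₂ m θ
  simp only [Finset.sum_add_distrib] at hsum
  rw [hsum θ, hsum ϑ] at h2
  simp only [lsObjective]
  linarith

/-- `k N` need not tend to infinity, for instance at points of weight zero. The bound `|a n| ≤ (ε /
2) n + C`, with `C` absorbing the finitely many early terms, handles all cases at once. -/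
lemma tendsto_comp_div_of_tendsto_div {a : ℕ → ℝ}
    (ha : Tendsto (fun n : ℕ => a n / n) atTop (𝓝 0)) (ha0 : a 0 = 0) {k : ℕ → ℕ}
    (hk : ∀ N, k N ≤ N) : Tendsto (fun N : ℕ => a (k N) / N) atTop (𝓝 0) := by
  rw [Metric.tendsto_atTop] at ha
  rw [Metric.tendsto_atTop]
  intro ε hε
  obtain ⟨n₀, hn₀⟩ := ha (ε / 2) (by positivity)
  set C : ℝ := ∑ i ∈ Finset.range n₀, |a i| with hC
  have hC0 : 0 ≤ C := Finset.sum_nonneg fun _ _ => abs_nonneg _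
  have hb : ∀ n, |a n| ≤ ε / 2 * n + C := by
    intro n
    rcases Nat.eq_zero_or_pos n with rfl | hn
    · simpa [ha0] using hC0
    have hn' : (0 : ℝ) < n := by exact_mod_cast hn
    by_cases h : n < n₀
    · have : |a n| ≤ C := Finset.single_le_sum (f := fun i => |a i|) (fun _ _ => abs_nonneg _)
        (Finset.mem_range.2 h)
      nlinarith
    · have := hn₀ n (not_lt.1 h)
      rw [Real.dist_eq, sub_zero, abs_div, Nat.abs_cast, div_lt_iff₀ hn'] at this
      linarith
  obtain ⟨N₀, hN₀⟩ := exists_nat_gt (2 * C / ε)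
  refine ⟨max N₀ 1, fun N hN => ?_⟩
  have hN1 : (0 : ℝ) < N := by exact_mod_cast lt_of_lt_of_le one_pos ((le_max_right _ _).trans hN)
  have hN2 : (N₀ : ℝ) ≤ N := by exact_mod_cast (le_max_left _ _).trans hN
  rw [Real.dist_eq, sub_zero, abs_div, Nat.abs_cast, div_lt_iff₀ hN1]
  have h1 : (k N : ℝ) ≤ N := by exact_mod_cast hk N
  have h2 : 2 * C < ε * N := by
    rw [div_lt_iff₀ hε] at hN₀
    nlinarith
  nlinarith [hb (k N)]

lemma tendsto_natCast_div_add (n : ℕ) :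
    Tendsto (fun N : ℕ => (N : ℝ) / (n + N)) atTop (𝓝 1) := by
  have h := tendsto_natCast_div_add_atTop (n : ℝ)
  simpa [add_comm] using h

lemma IsRounding.tendsto_div_add [MeasurableSpace X] {k : ℕ → (ξ : Design X) → Fin ξ.size → ℕ}
    (hk : IsRounding k) (n : ℕ) (ξ : Design X) (m : Fin ξ.size) :
    Tendsto (fun N : ℕ => (k N ξ m : ℝ) / (n + N)) atTop (𝓝 (ξ.wt m)) := by
  have h := (hk.tendsto ξ m).mul (tendsto_natCast_div_add n)
  rw [mul_one] at h
  refine h.congr' ?_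
  filter_upwards [eventually_gt_atTop 0] with N hN
  have : (N : ℝ) ≠ 0 := by positivity
  field_simp

/-- The leading term of the standardized estimation error after `N` observations under `ξ`, whose
numbers of replications are `k`. -/
noncomputable def linearizedError (η : X → Param p → ℝ) (θt : Param p) (n : ℝ) (ξ : Design X)
    (k : Fin ξ.size → ℕ) (e : ℕ → ℕ → ℝ) : Param p :=
  Matrix.toEuclideanCLM (𝕜 := ℝ) (infoMatrix η ξ θt)⁻¹
    ((√n)⁻¹ • weightedErrorSum (fun m => gradient (η (ξ.pt m)) θt) k e)

lemma Matrix.PosDef.toEuclideanCLM_inv_apply {n : Type*} [Fintype n] [DecidableEq n]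
    {A : Matrix n n ℝ} (hA : A.PosDef) (v : EuclideanSpace ℝ n) :
    Matrix.toEuclideanCLM (𝕜 := ℝ) A⁻¹ (Matrix.toEuclideanCLM (𝕜 := ℝ) A v) = v := by
  have h : A⁻¹ * A = 1 := Matrix.nonsing_inv_mul A ((Matrix.isUnit_iff_isUnit_det A).1 hA.isUnit)
  rw [← mul_apply_eq_comp, ← map_mul, h, map_one, one_apply_eq_self]

/-- Purely deterministic: the only property required of the second-stage errors is that their
averages at each point vanish in the limit. -/
lemma tendsto_standardizedError_sub_linearizedError [MeasurableSpace X] {Θ : Set (Param p)}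
    (hΘ : IsCompact Θ) (hθt : θt ∈ interior Θ)
    (hη_diff : ∀ x, ∀ θ ∈ Θ, DifferentiableAt ℝ (η x) θ)
    (hη_smooth : ∀ x, ContDiffAt ℝ 2 (η x) θt) {σ : ℝ} (hσ : 0 < σ) (n₁ : ℕ) {ξ₁ ξ₂ : Design X}
    {k₁ : Fin ξ₁.size → ℕ} {k₂ : ℕ → (ξ : Design X) → Fin ξ.size → ℕ} (hk₂ : IsRounding k₂)
    (hident : IdentifiesAt η Θ θt ξ₂) (hinfo : (infoMatrix η ξ₂ θt).PosDef)
    {e₁ e₂ : ℕ → ℕ → ℝ}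
    (he₂ : ∀ m, Tendsto (fun n : ℕ => (∑ j ∈ Finset.range n, e₂ m j) / n) atTop (𝓝 0))
    {θ : ℕ → Param p}
    (hθ : ∀ N, IsMLE Θ (totalLikelihood η σ θt ξ₁ k₁ ξ₂ (k₂ N ξ₂) e₁ e₂) (θ N)) :
    Tendsto (fun N : ℕ => (1 + ‖linearizedError η θt (n₁ + N) ξ₂ (k₂ N ξ₂) e₂‖)⁻¹ •
      (√((n₁ : ℝ) + N) • (θ N - θt) - linearizedError η θt (n₁ + N) ξ₂ (k₂ N ξ₂) e₂))
      atTop (𝓝 0) := by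
  have hr : Tendsto (fun N : ℕ => (n₁ : ℝ) + N) atTop atTop :=
    tendsto_atTop_add_const_left _ _ tendsto_natCast_atTop_atTop
  have hk := hk₂.tendsto_div_add n₁ ξ₂
  have hs : ∀ m, Tendsto (fun N : ℕ => (∑ j ∈ Finset.range (k₂ N ξ₂ m), e₂ m j) / ((n₁ : ℝ) + N))
      atTop (𝓝 0) := fun m => by
    have h1 := tendsto_comp_div_of_tendsto_div (he₂ m) (by simp) (k := fun N => k₂ N ξ₂ m)
      fun N => (Finset.single_le_sum (fun _ _ => Nat.zero_le _) (Finset.mem_univ m)).trans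
        (hk₂.sum_eq N ξ₂).le
    have h := h1.mul (tendsto_natCast_div_add n₁)
    rw [zero_mul] at h
    refine h.congr' ?_
    filter_upwards [eventually_gt_atTop 0] with N hN
    have : (N : ℝ) ≠ 0 := by positivity
    field_simp
  have hlim := tendsto_of_isMinOn_lsObjective hΘ
    (fun m θ hθ => (hη_diff (ξ₂.pt m) θ hθ).continuousAt.continuousWithinAt)
    (fun θ => Finset.sum_nonneg fun m _ => mul_nonneg (Nat.cast_nonneg _) (sq_nonneg _))
    ξ₂.wt_nonneg hident hr hk hs (fun N => (hθ N).1)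
    fun N => lsObjective_le_of_isMLE hσ (hθ N) (interior_subset hθt)
  have hlo := isLittleO_lsScore hθt (fun m => hη_smooth (ξ₂.pt m))
    (ContDiffAt.sum fun m _ => contDiffAt_const.mul
      ((contDiffAt_const.sub ((hη_smooth (ξ₁.pt m)).of_le (by norm_num))).pow 2))
    hr hk hs hlim fun N ϑ hϑ => lsObjective_le_of_isMLE hσ (hθ N) hϑ
  refine tendsto_smul_sub_of_isLittleO ?_
  have hcomp := ((Matrix.toEuclideanCLM (𝕜 := ℝ)
    (infoMatrix η ξ₂ θt)⁻¹).isBigO_comp _ _).trans_isLittleO hlo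
  refine hcomp.congr_left fun N => ?_
  rw [← toEuclideanCLM_sum_smul_vecMulVec, map_sub]
  congr 1
  exact hinfo.toEuclideanCLM_inv_apply _

end Path

/-! ### The limit law of the leading term -/

section Law

variable {Ω : Type*} [MeasurableSpace Ω] {P : Measure Ω}

lemma integral_cexp_sum_gaussianReal {ι : Type*} [Fintype ι] {Y : ι → Ω → ℝ} {v : NNReal}
    (hmeas : ∀ i, Measurable (Y i)) (hlaw : ∀ i, P.map (Y i) = gaussianReal 0 v)
    (hindep : iIndepFun Y P) (c : ι → ℝ) :
    ∫ ω, Complex.exp ((∑ i, c i * Y i ω : ℝ) * Complex.I) ∂P =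
      Complex.exp (-(v * ∑ i, c i ^ 2 : ℝ) / 2) := by
  have hcm : ∀ i, Measurable fun ω => c i * Y i ω := fun i => (hmeas i).const_mul _
  have hci : iIndepFun (fun i ω => c i * Y i ω) P :=
    hindep.comp (fun i x => c i * x) fun i => measurable_const_mul _
  -- Frequency `1` is enough, since the coefficients `c` already carry the direction.
  have hsum := congrFun (hci.charFun_map_fun_sum_eq_prod fun i => (hcm i).aemeasurable) 1
  rw [charFun_apply, integral_map (by fun_prop) (by fun_prop)] at hsum
  simp only [RCLike.inner_apply, conj_trivial, one_mul] at hsum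
  rw [hsum, Finset.prod_apply]
  have hi : ∀ i, charFun (P.map fun ω => c i * Y i ω) 1 =
      Complex.exp (-(v * c i ^ 2 : ℝ) / 2) := fun i => by
    have : (P.map fun ω => c i * Y i ω) = (gaussianReal 0 v).map (fun x => c i * x) := by
      rw [← hlaw i, Measure.map_map (measurable_const_mul _) (hmeas i)]; rfl
    rw [this, charFun_map_mul, charFun_gaussianReal]
    congr 1
    push_cast
    ring
  simp_rw [hi, ← Complex.exp_sum]
  congr 1
  push_cast
  rw [Finset.mul_sum, ← Finset.sum_neg_distrib, Finset.sum_div]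

lemma charFun_map_apply {E : Type*} [NormedAddCommGroup E] [InnerProductSpace ℝ E]
    [MeasurableSpace E] [BorelSpace E] [SecondCountableTopology E] {F : Ω → E} (hF : Measurable F)
    (t : E) :
    charFun (P.map F) t = ∫ ω, Complex.exp ((⟪F ω, t⟫ : ℝ) * Complex.I) ∂P := by
  rw [charFun_apply, integral_map hF.aemeasurable (by fun_prop)]

lemma charFun_map_prod {α β E : Type*} [MeasurableSpace α] [MeasurableSpace β]
    [NormedAddCommGroup E] [InnerProductSpace ℝ E] [MeasurableSpace E] [BorelSpace E]
    [SecondCountableTopology E] {μ : Measure α} {ν : Measure β} [IsProbabilityMeasure μ]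
    [IsProbabilityMeasure ν] {F : α × β → E} (hF : Measurable F) (t : E) :
    charFun ((μ.prod ν).map F) t =
      ∫ x, ∫ y, Complex.exp ((⟪F (x, y), t⟫ : ℝ) * Complex.I) ∂ν ∂μ := by
  have hm : Measurable fun q => Complex.exp ((⟪F q, t⟫ : ℝ) * Complex.I) := by fun_prop
  rw [charFun_map_apply hF, integral_prod _ (Integrable.of_bound hm.aestronglyMeasurable 1
    (Eventually.of_forall fun q => (Complex.norm_exp_ofReal_mul_I _).le))]

/-- Fubini for the product law. The independent copy `ω'` drives the errors while `ξ ω` stays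
frozen, which replaces conditioning on the design. -/
lemma charFun_map_of_indepFun [IsProbabilityMeasure P] {α β E : Type*} [MeasurableSpace α]
    [MeasurableSpace β] [NormedAddCommGroup E] [InnerProductSpace ℝ E] [MeasurableSpace E]
    [BorelSpace E] [SecondCountableTopology E] {F : α × β → E} (hF : Measurable F) {ξ : Ω → α}
    {e : Ω → β} (hξ : Measurable ξ) (he : Measurable e) (hind : IndepFun ξ e P) (t : E) :
    charFun (P.map fun ω => F (ξ ω, e ω)) t =
      ∫ ω, ∫ ω', Complex.exp ((⟪F (ξ ω, e ω'), t⟫ : ℝ) * Complex.I) ∂P ∂P := by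
  have hm : Measurable fun q => Complex.exp ((⟪F q, t⟫ : ℝ) * Complex.I) := by fun_prop
  have : IsProbabilityMeasure (P.map ξ) := Measure.isProbabilityMeasure_map hξ.aemeasurable
  have : IsProbabilityMeasure (P.map e) := Measure.isProbabilityMeasure_map he.aemeasurable
  have hprod := (indepFun_iff_map_prod_eq_prod_map_map hξ.aemeasurable he.aemeasurable).1 hind
  have hmap : (P.map fun ω => F (ξ ω, e ω)) = ((P.map ξ).prod (P.map e)).map F := by
    rw [← hprod, Measure.map_map hF (hξ.prodMk he)]
    rfl
  rw [hmap, charFun_map_prod hF, integral_map hξ.aemeasurable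
    (hm.stronglyMeasurable.integral_prod_right').aestronglyMeasurable]
  refine integral_congr_ae (Eventually.of_forall fun ω => ?_)
  exact integral_map he.aemeasurable (hm.comp measurable_prodMk_left).aestronglyMeasurable

variable {X : Type*} {p : ℕ} {η : X → Param p → ℝ} {θt : Param p}

lemma integral_cexp_inner_linearizedError {Y : ℕ × ℕ → Ω → ℝ} {v : NNReal}
    (hmeas : ∀ i, Measurable (Y i)) (hlaw : ∀ i, P.map (Y i) = gaussianReal 0 v)
    (hindep : iIndepFun Y P) {n : ℝ} (hn : 0 ≤ n) (ξ : Design X) (k : Fin ξ.size → ℕ)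
    (t : Param p) :
    ∫ ω, Complex.exp ((⟪linearizedError η θt n ξ k (fun m j => Y (m, j) ω), t⟫ : ℝ) *
        Complex.I) ∂P =
      Complex.exp (-(v * ∑ m, (k m / n) * ⟪Matrix.toEuclideanCLM (𝕜 := ℝ) (infoMatrix η ξ θt)⁻¹
        (gradient (η (ξ.pt m)) θt), t⟫ ^ 2 : ℝ) / 2) := by
  set A := Matrix.toEuclideanCLM (𝕜 := ℝ) (infoMatrix η ξ θt)⁻¹
  set c : (Σ m : Fin ξ.size, Fin (k m)) → ℝ := fun i =>
    (√n)⁻¹ * ⟪A (gradient (η (ξ.pt i.1)) θt), t⟫ with hc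
  -- Distinct observations use distinct errors. The coefficients do not depend on the repetition, so
  -- summing their squares produces the factor `k m / n`.
  set φ : (Σ m : Fin ξ.size, Fin (k m)) → ℕ × ℕ := fun i => (i.1, i.2) with hφ
  have hinj : Function.Injective φ := by
    rintro ⟨m, j⟩ ⟨m', j'⟩ h
    simp only [hφ, Prod.mk.injEq] at h
    obtain ⟨h1, h2⟩ := h
    obtain rfl := Fin.ext h1
    obtain rfl := Fin.ext h2
    rfl
  have h := integral_cexp_sum_gaussianReal (fun i => hmeas (φ i)) (fun i => hlaw (φ i))
    (hindep.precomp hinj) c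
  have hsq : ∑ i, c i ^ 2 = ∑ m, (k m / n) * ⟪A (gradient (η (ξ.pt m)) θt), t⟫ ^ 2 := by
    rw [Fintype.sum_sigma]
    refine Finset.sum_congr rfl fun m _ => ?_
    simp only [hc, mul_pow, inv_pow, Real.sq_sqrt hn, Finset.sum_const, Finset.card_univ,
      Fintype.card_fin, nsmul_eq_mul]
    ring
  rw [hsq] at h
  rw [← h]
  refine integral_congr_ae (Eventually.of_forall fun ω => ?_)
  have : ⟪linearizedError η θt n ξ k (fun m j => Y (m, j) ω), t⟫ = ∑ i, c i * Y (φ i) ω := by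
    rw [Fintype.sum_sigma, linearizedError, weightedErrorSum, map_smul, map_sum,
      real_inner_smul_left, sum_inner, Finset.mul_sum]
    refine Finset.sum_congr rfl fun m _ => ?_
    rw [map_smul, real_inner_smul_left, Finset.sum_range, Finset.sum_mul, Finset.mul_sum]
    refine Finset.sum_congr rfl fun j _ => ?_
    simp only [hc, hφ]
    ring
  simp only [this]

lemma Matrix.IsHermitian.inner_toEuclideanCLM {n : Type*} [Fintype n] [DecidableEq n]
    {A : Matrix n n ℝ} (hA : A.IsHermitian) (x y : EuclideanSpace ℝ n) :
    ⟪Matrix.toEuclideanCLM (𝕜 := ℝ) A x, y⟫ = ⟪x, Matrix.toEuclideanCLM (𝕜 := ℝ) A y⟫ := by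
  have h : ContinuousLinearMap.adjoint (Matrix.toEuclideanCLM (𝕜 := ℝ) A) =
      Matrix.toEuclideanCLM (𝕜 := ℝ) A := by
    rw [← ContinuousLinearMap.star_eq_adjoint, ← map_star, Matrix.star_eq_conjTranspose, hA.eq]
  conv_lhs => rw [← h]
  exact ContinuousLinearMap.adjoint_inner_left _ _ _

lemma invSqrt_isHermitian (A : Matrix (Fin (p + 1)) (Fin (p + 1)) ℝ) :
    (invSqrt A).IsHermitian :=
  (Matrix.nonneg_iff_posSemidef.1 (CFC.sqrt_nonneg A⁻¹)).isHermitian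

lemma invSqrt_mul_invSqrt {A : Matrix (Fin (p + 1)) (Fin (p + 1)) ℝ} (hA : A.PosDef) :
    invSqrt A * invSqrt A = A⁻¹ :=
  CFC.sqrt_mul_sqrt_self _ (Matrix.nonneg_iff_posSemidef.2 hA.inv.posSemidef)

/-- The sandwich `M⁻¹ M M⁻¹ = M⁻¹ = (M^{-1/2})²`, read as a quadratic form in `t`. -/
lemma sum_wt_mul_inner_sq {ξ : Design X} (h : (infoMatrix η ξ θt).PosDef) (t : Param p) :
    ∑ m, ξ.wt m * ⟪Matrix.toEuclideanCLM (𝕜 := ℝ) (infoMatrix η ξ θt)⁻¹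
        (gradient (η (ξ.pt m)) θt), t⟫ ^ 2 =
      ‖Matrix.toEuclideanCLM (𝕜 := ℝ) (invSqrt (infoMatrix η ξ θt)) t‖ ^ 2 := by
  set A := Matrix.toEuclideanCLM (𝕜 := ℝ) (infoMatrix η ξ θt)⁻¹ with hA
  have hAs : ∀ x y, ⟪A x, y⟫ = ⟪x, A y⟫ := h.inv.isHermitian.inner_toEuclideanCLM
  have h1 : ∑ m, ξ.wt m * ⟪A (gradient (η (ξ.pt m)) θt), t⟫ ^ 2 =
      ⟪Matrix.toEuclideanCLM (𝕜 := ℝ) (infoMatrix η ξ θt) (A t), A t⟫ := by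
    rw [infoMatrix, toEuclideanCLM_sum_smul_vecMulVec, sum_inner]
    refine Finset.sum_congr rfl fun m _ => ?_
    rw [real_inner_smul_left, hAs]
    ring
  rw [h1, ← hAs, h.toEuclideanCLM_inv_apply, hA, ← invSqrt_mul_invSqrt h, map_mul,
    mul_apply_eq_comp, (invSqrt_isHermitian _).inner_toEuclideanCLM, real_inner_self_eq_norm_sq]

lemma integral_cexp_inner_stdGaussian {B : Matrix (Fin (p + 1)) (Fin (p + 1)) ℝ}
    (hB : B.IsHermitian) (σ : ℝ) (t : Param p) :
    ∫ z, Complex.exp ((⟪σ • Matrix.toEuclideanCLM (𝕜 := ℝ) B z, t⟫ : ℝ) * Complex.I)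
        ∂(stdGaussian (Param p)) =
      Complex.exp (-(σ ^ 2 * ‖Matrix.toEuclideanCLM (𝕜 := ℝ) B t‖ ^ 2 : ℝ) / 2) := by
  have h := charFun_stdGaussian (E := Param p) (σ • Matrix.toEuclideanCLM (𝕜 := ℝ) B t)
  rw [charFun_apply] at h
  have e : ∀ z : Param p, ⟪σ • Matrix.toEuclideanCLM (𝕜 := ℝ) B z, t⟫ =
      ⟪z, σ • Matrix.toEuclideanCLM (𝕜 := ℝ) B t⟫ := fun z => by
    rw [real_inner_smul_left, real_inner_smul_right, hB.inner_toEuclideanCLM]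
  simp only [e]
  rw [h, norm_smul]
  congr 1
  push_cast
  rw [mul_pow, ← Complex.ofReal_pow ‖σ‖, Real.norm_eq_abs, sq_abs]
  push_cast
  ring

variable [MeasurableSpace X]

lemma measurable_linearizedError (hg : Measurable fun x => gradient (η x) θt) (n : ℝ)
    {k : (ξ : Design X) → Fin ξ.size → ℕ}
    (hk : Measurable fun ξ : Design X => (⟨ξ.size, k ξ⟩ : Σ M : ℕ, Fin M → ℕ)) :
    Measurable fun q : Design X × (ℕ → ℕ → ℝ) => linearizedError η θt n q.1 (k q.1) q.2 := by
  have h1 : Measurable fun q : Design X × (ℕ → ℕ → ℝ) => (infoMatrix η q.1 θt)⁻¹ :=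
    Matrix.measurable_inv.comp ((measurable_infoMatrix hg).comp measurable_fst)
  have h2 : Measurable fun q : Design X × (ℕ → ℕ → ℝ) => (√n)⁻¹ •
      weightedErrorSum (fun m => gradient (η (q.1.pt m)) θt) (k q.1) q.2 :=
    (measurable_weightedErrorSum hk hg).const_smul (√n)⁻¹
  simp only [linearizedError]
  have h3 := Matrix.measurable_toEuclideanCLM_apply.comp (h1.prodMk h2)
  exact h3

lemma measurable_invSqrt_infoMatrix_apply (hg : Measurable fun x => gradient (η x) θt) {σ : ℝ}
    {ξ : Ω → Design X} (hξ : Measurable ξ) :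
    Measurable fun q : Ω × Param p =>
      σ • Matrix.toEuclideanCLM (𝕜 := ℝ) (invSqrt (infoMatrix η (ξ q.1) θt)) q.2 := by
  have h1 : Measurable fun q : Ω × Param p => invSqrt (infoMatrix η (ξ q.1) θt) :=
    Matrix.measurable_cfcSqrt.comp (Matrix.measurable_inv.comp
      ((measurable_infoMatrix hg).comp (hξ.comp measurable_fst)))
  exact (Matrix.measurable_toEuclideanCLM_apply.comp (h1.prodMk measurable_snd)).const_smul σ

-- By Lévy's theorem it suffices to compare characteristic functions. Each is the mean over the
-- design of a Gaussian one; these converge for almost every design and are bounded by `1`.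
attribute [local irreducible] linearizedError in
theorem tendstoInDistribution_linearizedError [IsProbabilityMeasure P]
    (hg : Measurable fun x => gradient (η x) θt) {σ : ℝ} {Y : ℕ × ℕ → Ω → ℝ}
    (hmeas : ∀ i, Measurable (Y i))
    (hlaw : ∀ i, P.map (Y i) = gaussianReal 0 ⟨σ ^ 2, sq_nonneg σ⟩) (hindep : iIndepFun Y P)
    {ξ : Ω → Design X} (hξ : Measurable ξ)
    (hξY : IndepFun ξ (fun ω (m j : ℕ) => Y (m, j) ω) P)
    (n : ℕ) {k : ℕ → (ξ : Design X) → Fin ξ.size → ℕ} (hk : IsRounding k)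
    (hinfo : ∀ᵐ ω ∂P, (infoMatrix η (ξ ω) θt).PosDef) :
    TendstoInDistribution
      (fun (N : ℕ) ω => linearizedError η θt (n + N) (ξ ω) (k N (ξ ω)) fun m j => Y (m, j) ω) atTop
      (fun q : Ω × Param p =>
        σ • Matrix.toEuclideanCLM (𝕜 := ℝ) (invSqrt (infoMatrix η (ξ q.1) θt)) q.2)
      (fun _ => P) (P.prod (stdGaussian (Param p))) := by
  set e : Ω → ℕ → ℕ → ℝ := fun ω m j => Y (m, j) ω
  have hem : Measurable e :=
    measurable_pi_lambda _ fun m => measurable_pi_lambda _ fun j => hmeas (m, j)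
  have hF := fun N : ℕ => measurable_linearizedError hg ((n : ℝ) + N) (hk.measurable N)
  have hFω : ∀ N : ℕ, Measurable fun ω => linearizedError η θt (n + N) (ξ ω) (k N (ξ ω)) (e ω) :=
    fun N => (hF N).comp (hξ.prodMk hem)
  have hZ := measurable_invSqrt_infoMatrix_apply (p := p) (η := η) hg (σ := σ) hξ
  refine ⟨fun N => (hFω N).aemeasurable, hZ.aemeasurable, ?_⟩
  refine ProbabilityMeasure.tendsto_iff_tendsto_charFun.2 fun t => ?_
  have hlim : charFun ((P.prod (stdGaussian (Param p))).map fun q : Ω × Param p =>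
        σ • Matrix.toEuclideanCLM (𝕜 := ℝ) (invSqrt (infoMatrix η (ξ q.1) θt)) q.2) t =
      ∫ ω, Complex.exp (-(σ ^ 2 *
        ‖Matrix.toEuclideanCLM (𝕜 := ℝ) (invSqrt (infoMatrix η (ξ ω) θt)) t‖ ^ 2 : ℝ) / 2) ∂P := by
    rw [charFun_map_prod hZ]
    simp only [integral_cexp_inner_stdGaussian (invSqrt_isHermitian _)]
  have hinner : ∀ (N : ℕ) (ξ' : Design X),
      ∫ ω', Complex.exp ((⟪linearizedError η θt (n + N) ξ' (k N ξ') (e ω'), t⟫ : ℝ) *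
        Complex.I) ∂P =
      Complex.exp (-(σ ^ 2 * ∑ m, (k N ξ' m / ((n : ℝ) + N)) *
        ⟪Matrix.toEuclideanCLM (𝕜 := ℝ) (infoMatrix η ξ' θt)⁻¹
          (gradient (η (ξ'.pt m)) θt), t⟫ ^ 2 : ℝ) / 2) := fun N ξ' =>
    integral_cexp_inner_linearizedError hmeas hlaw hindep (by positivity) ξ' (k N ξ') t
  refine Tendsto.congr (fun N => (charFun_map_of_indepFun (hF N) hξ hem hξY t).symm) ?_
  refine Eq.subst (motive := fun z => Tendsto _ atTop (𝓝 z)) hlim.symm ?_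
  refine tendsto_integral_of_dominated_convergence (fun _ => 1) (fun N => ?_)
    (integrable_const _) (fun N => Eventually.of_forall fun ω => ?_) ?_
  · have hm : Measurable fun q : Ω × Ω => Complex.exp
        ((⟪linearizedError η θt (n + N) (ξ q.1) (k N (ξ q.1)) (e q.2), t⟫ : ℝ) * Complex.I) := by
      have h1 : Measurable fun q : Ω × Ω =>
          linearizedError η θt (n + N) (ξ q.1) (k N (ξ q.1)) (e q.2) :=
        (hF N).comp ((hξ.comp measurable_fst).prodMk (hem.comp measurable_snd))
      fun_prop
    exact (hm.stronglyMeasurable.integral_prod_right' (ν := P)).aestronglyMeasurable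
  · refine (norm_integral_le_of_norm_le_const (C := 1)
      (Eventually.of_forall fun y => (Complex.norm_exp_ofReal_mul_I _).le)).trans ?_
    simp
  · filter_upwards [hinfo] with ω hω
    simp only [hinner]
    rw [← sum_wt_mul_inner_sq hω t]
    have hreal : Tendsto (fun N : ℕ => σ ^ 2 * ∑ m, (k N (ξ ω) m / ((n : ℝ) + N)) *
        ⟪Matrix.toEuclideanCLM (𝕜 := ℝ) (infoMatrix η (ξ ω) θt)⁻¹
          (gradient (η ((ξ ω).pt m)) θt), t⟫ ^ 2) atTop (𝓝 (σ ^ 2 * ∑ m, (ξ ω).wt m *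
        ⟪Matrix.toEuclideanCLM (𝕜 := ℝ) (infoMatrix η (ξ ω) θt)⁻¹
          (gradient (η ((ξ ω).pt m)) θt), t⟫ ^ 2)) :=
      (tendsto_finsetSum _ fun m _ => (hk.tendsto_div_add n (ξ ω) m).mul_const _).const_mul _
    have hcont : Continuous fun x : ℝ => Complex.exp (-(x : ℂ) / 2) := by fun_prop
    exact (hcont.tendsto _).comp hreal

end Law

/-! ### Limit law of the two-stage maximum likelihood estimator -/

section Errors

variable {Ω : Type*} [MeasurableSpace Ω] {P : Measure Ω}

lemma comap_pi_le_iSup_range {Ω ι κ β : Type*} [MeasurableSpace β] (f : ι → Ω → β) (u : κ → ι) :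
    MeasurableSpace.comap (fun ω a => f (u a) ω) MeasurableSpace.pi ≤
      ⨆ i ∈ Set.range u, MeasurableSpace.comap (f i) inferInstance := by
  rw [MeasurableSpace.pi, MeasurableSpace.comap_iSup]
  refine iSup_le fun a => ?_
  rw [MeasurableSpace.comap_comp]
  exact le_iSup₂_of_le (u a) (Set.mem_range_self a) le_rfl

lemma ProbabilityTheory.iIndepFun.indepFun_of_disjoint_range {ι κ κ' β : Type*}
    [MeasurableSpace β] {f : ι → Ω → β} (hf : iIndepFun f P) (hmeas : ∀ i, Measurable (f i))
    {u : κ → ι} {v : κ' → ι} (huv : Disjoint (Set.range u) (Set.range v)) :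
    IndepFun (fun ω a => f (u a) ω) (fun ω b => f (v b) ω) P := by
  have h := indep_iSup_of_disjoint (fun i => (hmeas i).comap_le) hf huv
  rw [IndepFun_iff_Indep]
  exact indep_of_indep_of_le_left
    (indep_of_indep_of_le_right h (comap_pi_le_iSup_range f v)) (comap_pi_le_iSup_range f u)

/-- The strong law is applied to each of countably many rows, so one null set serves every design
the first stage may produce. -/
lemma ae_tendsto_average_gaussianReal {Y : ℕ × ℕ → Ω → ℝ} {v : NNReal}
    (hmeas : ∀ i, Measurable (Y i)) (hlaw : ∀ i, P.map (Y i) = gaussianReal 0 v)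
    (hindep : iIndepFun Y P) :
    ∀ᵐ ω ∂P, ∀ m, Tendsto (fun n : ℕ => (∑ j ∈ Finset.range n, Y (m, j) ω) / n) atTop (𝓝 0) := by
  refine ae_all_iff.2 fun m => ?_
  have hid : Integrable (fun x : ℝ => x) (P.map (Y (m, 0))) := by
    rw [hlaw]
    exact memLp_one_iff_integrable.1 (memLp_id_gaussianReal 1)
  have hint : Integrable (Y (m, 0)) P := hid.comp_measurable (hmeas _)
  have hzero : ∫ ω, Y (m, 0) ω ∂P = 0 := by
    rw [← integral_map (f := fun x : ℝ => x) (hmeas (m, 0)).aemeasurable (by fun_prop), hlaw,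
      integral_id_gaussianReal]
  have h := strong_law_ae_real (fun j => Y (m, j)) hint
    (fun i j hij => hindep.indepFun (by simpa using hij))
    (fun j => ⟨(hmeas _).aemeasurable, (hmeas _).aemeasurable, by rw [hlaw, hlaw]⟩)
  rwa [hzero] at h

end Errors

lemma measurable_sampleMean {X : Type*} {p M : ℕ} (η : X → Param p → ℝ) (θt : Param p)
    (x : Fin M → X) (k : Fin M → ℕ) : Measurable fun e : ℕ → ℕ → ℝ => sampleMean η θt x k e := by
  refine measurable_pi_lambda _ fun m => ?_
  unfold sampleMean
  fun_prop

theorem theorem2 {X Ω : Type*} [MeasurableSpace X] [MeasurableSpace Ω]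
    (P : Measure Ω) [IsProbabilityMeasure P] {p : ℕ}
    -- the regression model: mean function, compact parameter set, true parameter
    (η : X → Param p → ℝ) (Θ : Set (Param p)) (hΘ : IsCompact Θ)
    (θt : Param p) (hθt : θt ∈ interior Θ)
    (hη_meas : ∀ θ ∈ Θ, Measurable fun x => η x θ)
    (hη_diff : ∀ x, ∀ θ ∈ Θ, DifferentiableAt ℝ (η x) θ)
    (hη_smooth : ∀ x, ContDiffAt ℝ 3 (η x) θt)
    -- the errors `ε (i, m, j)` of stage `i`, point `m`, repetition `j`: i.i.d. `N(0, σ²)`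
    (σ : ℝ) (hσ : 0 < σ) (ε : Fin 2 × ℕ × ℕ → Ω → ℝ)
    (hε_meas : ∀ i, Measurable (ε i))
    (hε_law : ∀ i, P.map (ε i) = gaussianReal 0 ⟨σ ^ 2, sq_nonneg σ⟩)
    (hε_indep : iIndepFun ε P)
    -- the first stage: `n₁` observations, allocated according to the design `ξ₁`, and the MLE
    (n₁ : ℕ) (ξ₁ : Design X) (k₁ : Fin ξ₁.size → ℕ) (hk₁ : ∀ m, (k₁ m : ℝ) = n₁ * ξ₁.wt m)
    (θhat₁ : (Fin ξ₁.size → ℝ) → Param p)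
    (hθhat₁ : ∀ ybar, IsMLE Θ (stageLikelihood η σ ξ₁.pt k₁ ybar) (θhat₁ ybar))
    -- the locally optimal designs and the second stage design
    (Φ : Matrix (Fin (p + 1)) (Fin (p + 1)) ℝ → EReal) (ξopt : Param p → Design X)
    (hξopt : ∀ θ ∈ Θ, IsLocallyOptimal η Φ θ (ξopt θ))
    (hξopt_meas : Measurable fun ybar => ξopt (θhat₁ ybar))
    (ξ₂ : Ω → Design X)
    (hξ₂ : ∀ ω, ξ₂ ω = secondDesign η θt ξ₁ k₁ θhat₁ ξopt fun m j => ε (0, m, j) ω)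
    (k₂ : ℕ → (ξ : Design X) → Fin ξ.size → ℕ) (hk₂ : IsRounding k₂)
    -- identifiability, and regularity of the information matrix, under the second stage design
    (hident : ∀ᵐ ω ∂P, IdentifiesAt η Θ θt (ξ₂ ω))
    (hinfo : ∀ᵐ ω ∂P, (infoMatrix η (ξ₂ ω) θt).PosDef)
    -- the MLE based on all observations, with `N` observations in the second stage
    (θhat : ℕ → Ω → Param p) (hθhat_meas : ∀ N, AEMeasurable (θhat N) P)
    (hθhat : ∀ N, ∀ᵐ ω ∂P, IsMLE Θ
      (totalLikelihood η σ θt ξ₁ k₁ (ξ₂ ω) (k₂ N (ξ₂ ω))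
        (fun m j => ε (0, m, j) ω) (fun m j => ε (1, m, j) ω)) (θhat N ω)) :
    TendstoInDistribution
      (fun (N : ℕ) (ω : Ω) => √((n₁ : ℝ) + N) • (θhat N ω - θt)) atTop
      (fun q : Ω × Param p =>
        σ • Matrix.toEuclideanCLM (𝕜 := ℝ) (invSqrt (infoMatrix η (ξ₂ q.1) θt)) q.2)
      (fun _ => P) (P.prod (stdGaussian (Param p))) := by
  set Y : ℕ × ℕ → Ω → ℝ := fun i => ε (1, i.1, i.2) with hY
  have hYmeas : ∀ i, Measurable (Y i) := fun i => hε_meas _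
  have hYlaw : ∀ i, P.map (Y i) = gaussianReal 0 ⟨σ ^ 2, sq_nonneg σ⟩ := fun i => hε_law _
  have hYindep : iIndepFun Y P := hε_indep.precomp (g := fun i : ℕ × ℕ => ((1 : Fin 2), i.1, i.2))
    fun i j h => by simpa [Prod.ext_iff] using h
  have he : ∀ i : Fin 2, Measurable fun ω (m j : ℕ) => ε (i, m, j) ω := fun i =>
    measurable_pi_lambda _ fun m => measurable_pi_lambda _ fun j => hε_meas _
  have hdesign : Measurable fun e : ℕ → ℕ → ℝ => secondDesign η θt ξ₁ k₁ θhat₁ ξopt e :=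
    hξopt_meas.comp (measurable_sampleMean η θt ξ₁.pt k₁)
  have hξ₂_eq : ξ₂ = fun ω => secondDesign η θt ξ₁ k₁ θhat₁ ξopt fun m j => ε (0, m, j) ω :=
    funext hξ₂
  have hξ₂_meas : Measurable ξ₂ := hξ₂_eq ▸ hdesign.comp (he 0)
  -- The design reads only errors with first index `0`, and `Y` only those with index `1`.
  have hξY : IndepFun ξ₂ (fun ω (m j : ℕ) => Y (m, j) ω) P := by
    have h := hε_indep.indepFun_of_disjoint_range hε_meas
      (u := fun i : ℕ × ℕ => ((0 : Fin 2), i.1, i.2))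
      (v := fun i : ℕ × ℕ => ((1 : Fin 2), i.1, i.2)) (by
        rw [Set.disjoint_left]
        rintro _ ⟨i, rfl⟩ ⟨j, h⟩
        simp at h)
    have hcurry : Measurable fun (y : ℕ × ℕ → ℝ) (m j : ℕ) => y (m, j) :=
      measurable_pi_lambda _ fun m => measurable_pi_lambda _ fun j => measurable_pi_apply _
    rw [hξ₂_eq]
    exact h.comp (hdesign.comp hcurry) hcurry
  have hg := measurable_gradient hθt hη_meas fun x => hη_diff x θt (interior_subset hθt)
  set S : ℕ → Ω → Param p := fun N ω =>
    linearizedError η θt (n₁ + N) (ξ₂ ω) (k₂ N (ξ₂ ω)) fun m j => Y (m, j) ω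
  have hSlim : TendstoInDistribution S atTop _ (fun _ => P) (P.prod (stdGaussian (Param p))) :=
    tendstoInDistribution_linearizedError hg hYmeas hYlaw hYindep hξ₂_meas hξY n₁ hk₂ hinfo
  set V : ℕ → Ω → Param p := fun N ω =>
    (1 + ‖S N ω‖)⁻¹ • (√((n₁ : ℝ) + N) • (θhat N ω - θt) - S N ω) with hV
  have hVmeas : ∀ N, AEMeasurable (V N) P := fun N => by
    have h1 := hSlim.forall_aemeasurable N
    have h2 := hθhat_meas N
    fun_prop
  have hVlim : TendstoInMeasure P V atTop fun _ => 0 := by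
    refine tendstoInMeasure_of_tendsto_ae (fun N => (hVmeas N).aestronglyMeasurable) ?_
    filter_upwards [hident, hinfo, ae_all_iff.2 hθhat,
      ae_tendsto_average_gaussianReal hYmeas hYlaw hYindep] with ω h1 h2 h3 h4
    exact tendsto_standardizedError_sub_linearizedError hΘ hθt hη_diff
      (fun x => (hη_smooth x).of_le (by norm_num)) hσ n₁ hk₂ h1 h2 h4 h3
  -- This `g` undoes the normalization in `V`, so `g (S, V)` is the standardized error, and `g (S,
  -- 0) = S` in the limit.
  have hslutsky := hSlim.continuous_comp_prodMk_of_tendstoInMeasure_const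
    (g := fun q : Param p × Param p => q.1 + (1 + ‖q.1‖) • q.2) (by fun_prop) hVlim hVmeas
  refine hslutsky.congr (fun N => Eventually.of_forall fun ω => ?_)
    (Eventually.of_forall fun q => ?_)
  · have : 1 + ‖S N ω‖ ≠ 0 := by positivity
    simp only [hV]
    rw [smul_inv_smul₀ this, add_sub_cancel]
  · simp
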